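/- Theorem. A function $f:(0,\infty)\to(0,\infty)$ is called matrix monotone if for every $n$ and all positive definite matrices $A,B\in M_n(\mathbb C)$ with $A\le B$ one has $f(A)\le f(B)$; it is called standard if moreover $x f(x^{-1})=f(x)$ for all $x>0$ and $f(1)=1$. For a positive definite matrix $D\in M_n(\mathbb C)$ let $\mathbb L_D X=DX$ and $\mathbb R_D X=XD$ be the left and right multiplications on $M_n(\mathbb C)$, put $$\mathbb J_D^f=f(\mathbb L_D\mathbb R_D^{-1})\,\mathbb R_D : M_n(\mathbb C)\to M_n(\mathbb C),$$ where $f(\cdot)$ is the functional calculus of the operator $\mathbb L_D\mathbb R_D^{-1}$, which is positive for the Hilbert–Schmidt inner product $\langle B,C\rangle=\mathrm{Tr}\,B^*C$, and let $$\gamma_D^f(A,B)=\mathrm{Tr}\,A\,(\mathbb J_D^f)^{-1}(B).$$ Let $f$ be a standard matrix monotone function and let $A\in M_n(\mathbb C)$ be self-adjoint. Then for every positive definite $D\in M_n(\mathbb C)$ the map $\mathbb J_D^f$ is invertible and $\gamma_D^f(A,A)$ is a real number, and $D\mapsto\gamma_D^f(A,A)$ is a convex function on the set of positive definite matrices in $M_n(\mathbb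 C)$. -/

import Mathlib

open scoped ComplexOrder

/-- `f` is matrix (operator) monotone on `(0, ∞)`: for matrices of every size, `0 < A ≤ B` implies
`f(A) ≤ f(B)`, where `f(A)` is the functional calculus of Hermitian matrices. -/
def IsMatrixMonotone (f : ℝ → ℝ) : Prop :=
  ∀ (n : ℕ) (A B : Matrix (Fin n) (Fin n) ℂ), A.PosDef → B.PosDef →
    (B - A).PosSemidef → (cfc f B - cfc f A).PosSemidef

/-- Standard matrix monotone functions `f : (0, ∞) → (0, ∞)`; the values of `f` outside `(0, ∞)`
play no role. -/
structure IsStandardMatrixMonotone (f : ℝ → ℝ) : Prop where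
  pos : ∀ x : ℝ, 0 < x → 0 < f x
  monotone : IsMatrixMonotone f
  symm : ∀ x : ℝ, 0 < x → x * f x⁻¹ = f x
  map_one : f 1 = 1

/-- The functional calculus `f(T)` of a linear map `T` on `n × n` matrices that is self-adjoint for
the Hilbert–Schmidt inner product `⟨B, C⟩ = Tr B* C`. The matrix units form an orthonormal
basis for this inner product, so that passing to the representing `n² × n²` matrix is a
`*`-isomorphism, and `f(T)` is the map represented by `f` of the matrix representing `T`. -/
noncomputable def superCfc {n : ℕ} (f : ℝ → ℝ)
    (T : Module.End ℂ (Matrix (Fin n) (Fin n) ℂ)) :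
    Module.End ℂ (Matrix (Fin n) (Fin n) ℂ) :=
  Matrix.toLin (Matrix.stdBasis ℂ (Fin n) (Fin n)) (Matrix.stdBasis ℂ (Fin n) (Fin n))
    (cfc f (LinearMap.toMatrix (Matrix.stdBasis ℂ (Fin n) (Fin n))
      (Matrix.stdBasis ℂ (Fin n) (Fin n)) T))

/-- The linear map `L_D R_D⁻¹ : X ↦ D X D⁻¹` on `n × n` matrices. -/
noncomputable def modularOp {n : ℕ} (D : Matrix (Fin n) (Fin n) ℂ) :
    Module.End ℂ (Matrix (Fin n) (Fin n) ℂ) :=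
  LinearMap.mulLeft ℂ D * LinearMap.mulRight ℂ D⁻¹

/-- `J_D^f = f(L_D R_D⁻¹) R_D`. -/
noncomputable def jOp {n : ℕ} (f : ℝ → ℝ) (D : Matrix (Fin n) (Fin n) ℂ) :
    Module.End ℂ (Matrix (Fin n) (Fin n) ℂ) :=
  superCfc f (modularOp D) * LinearMap.mulRight ℂ D

/-- `γ_D^f(A, B) = Tr A (J_D^f)⁻¹(B)`; `Ring.inverse` is the inverse linear map of an invertible
linear map. -/
noncomputable def monotoneMetric {n : ℕ} (f : ℝ → ℝ) (D A B : Matrix (Fin n) (Fin n) ℂ) : ℂ :=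
  (A * (Ring.inverse (jOp f D)) B).trace

/-! ### Functional calculus of matrices and the operator Jensen inequality. -/

section OperatorJensen

open Matrix Polynomial
open scoped MatrixOrder

variable {m n : Type*} [Fintype m] [DecidableEq m] [Fintype n] [DecidableEq n]

/-! In the basis of matrix units, `J_D^f` is the perspective `f(L R⁻¹) R` of the commuting matrices
`L = D ⊗ 1`, `R = 1 ⊗ Dᵀ`, both linear in `D`. The perspective is homogeneous and superadditive
(`perspective_add_le`), so `J_D^f` is concave in `D` (`jMatrix_concave`). Superadditivity is the
operator Jensen inequality `V* f(T) V ≤ f(V* T V)` for an isometry `V` (`jensen`), proved by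
comparing `T` with a block diagonal matrix. Convexity of `γ` follows because `⟨a, M⁻¹ a⟩` is the
maximum over `b` of `2 Re⟨a, b⟩ - ⟨b, M b⟩`, which is affine and decreasing in `M`
(`two_re_sub_le`). -/

/-- Spectra of matrices are finite, so one interpolating polynomial can replace `f` on several of
them at once; algebra homomorphisms then commute with the functional calculus. -/
theorem exists_polynomial_eqOn {s : Set ℝ} (hs : s.Finite) (f : ℝ → ℝ) :
    ∃ p : ℝ[X], Set.EqOn f (fun x => p.eval x) s := by
  classical
  refine ⟨Lagrange.interpolate hs.toFinset id f, fun x hx => ?_⟩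
  exact (Lagrange.eval_interpolate_at_node (v := id) f Function.injective_id.injOn
    (hs.mem_toFinset.2 hx)).symm

theorem Matrix.IsHermitian.cfc_eq_aeval {A : Matrix n n ℂ} (hA : A.IsHermitian) {f : ℝ → ℝ}
    {p : ℝ[X]} (h : Set.EqOn f (fun x => p.eval x) (spectrum ℝ A)) : cfc f A = aeval A p := by
  rw [cfc_congr h, cfc_polynomial p A hA.isSelfAdjoint]

theorem Matrix.continuousOn_spectrum (A : Matrix n n ℂ) (f : ℝ → ℝ) :
    ContinuousOn f (spectrum ℝ A) :=
  Matrix.finite_real_spectrum.continuousOn f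

theorem Matrix.PosDef.pos_of_mem_spectrum {A : Matrix n n ℂ} (hA : A.PosDef) {x : ℝ}
    (hx : x ∈ spectrum ℝ A) : 0 < x := by
  rw [hA.isHermitian.spectrum_real_eq_range_eigenvalues] at hx
  obtain ⟨i, rfl⟩ := hx
  exact hA.eigenvalues_pos i

theorem Matrix.PosDef.posDef_cfc {A : Matrix n n ℂ} (hA : A.PosDef) {f : ℝ → ℝ}
    (hf : ∀ x, 0 < x → 0 < f x) : (cfc f A).PosDef := by
  refine PosSemidef.posDef_iff_isUnit ?_ |>.2 ?_
  · exact nonneg_iff_posSemidef.1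
      (cfc_nonneg fun x hx => (hf x (hA.pos_of_mem_spectrum hx)).le)
  · exact (isUnit_cfc_iff f A (A.continuousOn_spectrum f) hA.isHermitian.isSelfAdjoint).2
      fun x hx => (hf x (hA.pos_of_mem_spectrum hx)).ne'

/-- A matrix monotone function is monotone on matrices with an arbitrary finite index type. -/
theorem IsMatrixMonotone.cfc_le_cfc {f : ℝ → ℝ} (hf : IsMatrixMonotone f) {A B : Matrix n n ℂ}
    (hA : A.PosDef) (hAB : A ≤ B) : cfc f A ≤ cfc f B := by
  have hB : B.PosDef := by simpa using hA.add_posSemidef (le_iff.1 hAB)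
  let e := Fintype.equivFin n
  have key : ∀ C : Matrix n n ℂ, C.IsHermitian →
      cfc f (C.submatrix e.symm e.symm) = (cfc f C).submatrix e.symm e.symm := by
    intro C hC
    obtain ⟨p, hp⟩ := exists_polynomial_eqOn
      ((Matrix.finite_real_spectrum (A := C)).union
        (Matrix.finite_real_spectrum (A := C.submatrix e.symm e.symm))) f
    rw [hC.cfc_eq_aeval (hp.mono Set.subset_union_left),
      (hC.submatrix e.symm).cfc_eq_aeval (hp.mono Set.subset_union_right)]
    exact aeval_algHom_apply (Matrix.reindexAlgEquiv ℝ ℂ e) C p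
  have h := hf _ (A.submatrix e.symm e.symm) (B.submatrix e.symm e.symm)
    (hA.submatrix e.symm.injective) (hB.submatrix e.symm.injective)
    ((le_iff.1 hAB).submatrix e.symm)
  rw [key A hA.isHermitian, key B hB.isHermitian] at h
  rw [le_iff]
  simpa [Matrix.submatrix_sub] using h.submatrix e

/-- The embedding of `Mₙ × Mₘ` into `Mₙ₊ₘ` as block diagonal matrices. -/
noncomputable def Matrix.fromBlocksAlgHom :
    Matrix n n ℂ × Matrix m m ℂ →ₐ[ℝ] Matrix (n ⊕ m) (n ⊕ m) ℂ where
  toFun A := fromBlocks A.1 0 0 A.2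
  map_one' := by simp
  map_mul' A B := by simp [fromBlocks_multiply]
  map_zero' := by simp
  map_add' A B := by simp [fromBlocks_add]
  commutes' r := by
    ext (i | i) (j | j) <;> simp [Matrix.algebraMap_matrix_apply]

theorem Matrix.cfc_fromBlocks {A : Matrix n n ℂ} {B : Matrix m m ℂ} (hA : A.IsHermitian)
    (hB : B.IsHermitian) (f : ℝ → ℝ) :
    cfc f (fromBlocks A 0 0 B) = fromBlocks (cfc f A) 0 0 (cfc f B) := by
  obtain ⟨p, hp⟩ := exists_polynomial_eqOn
    (((Matrix.finite_real_spectrum (A := A)).union (Matrix.finite_real_spectrum (A := B))).union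
      (Matrix.finite_real_spectrum (A := fromBlocks A 0 0 B))) f
  rw [hA.cfc_eq_aeval (hp.mono (Set.subset_union_left.trans Set.subset_union_left)),
    hB.cfc_eq_aeval (hp.mono (Set.subset_union_right.trans Set.subset_union_left)),
    (hA.fromBlocks (by simp) hB).cfc_eq_aeval (hp.mono Set.subset_union_right)]
  have h := aeval_algHom_apply (fromBlocksAlgHom (n := n) (m := m)) (A, B) p
  have h1 := aeval_algHom_apply (AlgHom.fst ℝ (Matrix n n ℂ) (Matrix m m ℂ)) (A, B) p
  have h2 := aeval_algHom_apply (AlgHom.snd ℝ (Matrix n n ℂ) (Matrix m m ℂ)) (A, B) p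
  simp only [AlgHom.fst_apply, AlgHom.snd_apply] at h1 h2
  rw [h1, h2]
  exact h

/-- For an isometry `V`, the embedding `(Y, a) ↦ V Y V* + a (1 - V V*)`. -/
noncomputable def Matrix.isometryAlgHom (V : Matrix m n ℂ) (hV : Vᴴ * V = 1) :
    Matrix n n ℂ × ℝ →ₐ[ℝ] Matrix m m ℂ where
  toFun A := V * A.1 * Vᴴ + A.2 • (1 - V * Vᴴ)
  map_one' := by simp
  map_mul' A B := by
    have h : ∀ X : Matrix n m ℂ, Vᴴ * (V * X) = X := fun X => by
      rw [← Matrix.mul_assoc, hV, Matrix.one_mul]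
    simp [Matrix.mul_add, Matrix.add_mul, Matrix.mul_sub, Matrix.sub_mul, Matrix.mul_assoc, h,
      mul_smul, smul_sub, smul_comm A.2 B.2]
  map_zero' := by simp
  map_add' A B := by
    simp only [Prod.fst_add, Prod.snd_add, Matrix.mul_add, Matrix.add_mul, add_smul]
    abel
  commutes' r := by
    simp [Algebra.algebraMap_eq_smul_one, smul_sub]

theorem Matrix.cfc_isometry {V : Matrix m n ℂ} (hV : Vᴴ * V = 1) {Y : Matrix n n ℂ}
    (hY : Y.IsHermitian) (a : ℝ) (f : ℝ → ℝ) :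
    cfc f (V * Y * Vᴴ + a • (1 - V * Vᴴ)) = V * cfc f Y * Vᴴ + f a • (1 - V * Vᴴ) := by
  have hS : (V * Y * Vᴴ + a • (1 - V * Vᴴ)).IsHermitian := by
    simp [IsHermitian, conjTranspose_mul, Matrix.mul_assoc, hY.eq]
  obtain ⟨p, hp⟩ := exists_polynomial_eqOn
    (((Matrix.finite_real_spectrum (A := Y)).union (Set.finite_singleton a)).union
      (Matrix.finite_real_spectrum (A := V * Y * Vᴴ + a • (1 - V * Vᴴ)))) f
  rw [hY.cfc_eq_aeval (hp.mono (Set.subset_union_left.trans Set.subset_union_left)),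
    show f a = p.eval a from hp (Or.inl (Or.inr rfl)),
    hS.cfc_eq_aeval (hp.mono Set.subset_union_right)]
  have h := aeval_algHom_apply (isometryAlgHom V hV) (Y, a) p
  have h1 := aeval_algHom_apply (AlgHom.fst ℝ (Matrix n n ℂ) ℝ) (Y, a) p
  have h2 := aeval_algHom_apply (AlgHom.snd ℝ (Matrix n n ℂ) ℝ) (Y, a) p
  simp only [AlgHom.fst_apply, AlgHom.snd_apply, coe_aeval_eq_eval] at h1 h2
  rw [h1, h2]
  exact h

theorem IsMatrixMonotone.le_of_le {f : ℝ → ℝ} (hf : IsMatrixMonotone f) {x y : ℝ} (hx : 0 < x)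
    (hxy : x ≤ y) : f x ≤ f y := by
  have h := hf.cfc_le_cfc (n := Unit) (A := algebraMap ℝ _ x) (B := algebraMap ℝ _ y) ?_ ?_
  · rw [cfc_algebraMap, cfc_algebraMap, le_iff, ← map_sub] at h
    have := h.diag_nonneg (i := ())
    simpa [Matrix.algebraMap_matrix_apply, -map_sub] using this
  · rw [Algebra.algebraMap_eq_smul_one]
    exact PosDef.one.smul hx
  · rw [le_iff, ← map_sub, Algebra.algebraMap_eq_smul_one]
    exact PosSemidef.one.smul (sub_nonneg.2 hxy)

/-- By symmetry `f x / x = f x⁻¹`, which decreases in `x`. -/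
theorem IsStandardMatrixMonotone.map_mul_le {f : ℝ → ℝ} (hf : IsStandardMatrixMonotone f)
    {c x : ℝ} (hc : 1 ≤ c) (hx : 0 < x) : f (c * x) ≤ c * f x := by
  have hc0 : 0 < c := by linarith
  rw [← hf.symm (c * x) (by positivity), ← hf.symm x hx, mul_assoc]
  have : f (c * x)⁻¹ ≤ f x⁻¹ := by
    refine hf.monotone.le_of_le (by positivity) ?_
    gcongr
    nlinarith
  gcongr

theorem IsStandardMatrixMonotone.cfc_smul_le {f : ℝ → ℝ} (hf : IsStandardMatrixMonotone f)
    {c : ℝ} (hc : 1 ≤ c) {X : Matrix n n ℂ} (hX : X.PosDef) :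
    cfc f (c • X) ≤ c • cfc f X := by
  rw [← cfc_comp_smul c f X ((Matrix.finite_real_spectrum.image _).continuousOn f)
    hX.isHermitian.isSelfAdjoint, ← cfc_smul c f X (X.continuousOn_spectrum f)]
  exact cfc_mono (fun x hx => hf.map_mul_le hc (hX.pos_of_mem_spectrum hx))
    (X.continuousOn_spectrum _) (X.continuousOn_spectrum _)

theorem Matrix.IsHermitian.exists_le_smul_one {A : Matrix n n ℂ} (hA : A.IsHermitian) :
    ∃ a : ℝ, A ≤ a • 1 := by
  obtain ⟨b, hb⟩ := (Matrix.finite_real_spectrum (A := A)).bddAbove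
  refine ⟨b, ?_⟩
  rw [← Algebra.algebraMap_eq_smul_one]
  exact (le_algebraMap_iff_spectrum_le hA.isSelfAdjoint).2
    fun x hx => hb hx

omit [DecidableEq n] in
theorem Matrix.nonneg_of_forall_add_smul {A B : Matrix n n ℂ}
    (h : ∀ ε : ℝ, 0 < ε → 0 ≤ A + ε • B) : 0 ≤ A := by
  have hc : Filter.Tendsto (fun ε : ℝ => A + ε • B) (nhdsWithin 0 (Set.Ioi 0)) (nhds A) := by
    have : Continuous fun ε : ℝ => A + ε • B := by fun_prop
    simpa using (this.tendsto 0).mono_left nhdsWithin_le_nhds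
  have hherm : A.IsHermitian := by
    have h1 := (h 1 one_pos)
    have h2 := (h 2 two_pos)
    rw [nonneg_iff_posSemidef] at h1 h2
    -- `A = 2 (A + B) - (A + 2 B)`.
    have := (h1.isHermitian.smul (k := (2 : ℝ)) (by simp [IsSelfAdjoint])).sub h2.isHermitian
    convert this using 1
    module
  refine nonneg_iff_posSemidef.2 (.of_dotProduct_mulVec_nonneg hherm fun x => ?_)
  have hq : Continuous fun M : Matrix n n ℂ => star x ⬝ᵥ (M *ᵥ x) := by fun_prop
  refine ge_of_tendsto ((hq.tendsto A).comp hc) ?_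
  filter_upwards [self_mem_nhdsWithin] with ε hε
  exact (nonneg_iff_posSemidef.1 (h ε hε)).dotProduct_mulVec_nonneg x

/-- The operator Jensen inequality for an isometry. -/
theorem IsStandardMatrixMonotone.jensen {f : ℝ → ℝ} (hf : IsStandardMatrixMonotone f)
    {V : Matrix m n ℂ} (hV : Vᴴ * V = 1) {T : Matrix m m ℂ} (hT : T.PosDef) :
    Vᴴ * cfc f T * V ≤ cfc f (Vᴴ * T * V) := by
  have hinj : Function.Injective V.mulVec := by
    intro x y hxy
    simpa [hV] using congrArg (Vᴴ *ᵥ ·) hxy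
  have hX : (Vᴴ * T * V).PosDef := hT.conjTranspose_mul_mul_same hinj
  rw [← sub_nonneg]
  refine nonneg_of_forall_add_smul (B := cfc f (Vᴴ * T * V)) fun ε hε => ?_
  set X := Vᴴ * T * V with hXdef
  obtain ⟨b, hb⟩ := hT.isHermitian.exists_le_smul_one
  -- Large enough to absorb the off-diagonal blocks of `T` relative to `V V*`, at the cost of the
  -- factor `1 + ε` on the corner.
  set a : ℝ := (1 + ε⁻¹) * b
  set S := V * ((1 + ε) • X) * Vᴴ + a • (1 - V * Vᴴ) with hS
  have hTS : T ≤ S := by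
    set P := V * Vᴴ with hP
    have hPh : Pᴴ = P := by simp [hP]
    have hPP : P * P = P := by
      rw [hP, Matrix.mul_assoc, ← Matrix.mul_assoc Vᴴ, hV, Matrix.one_mul]
    have h1 : (((ε • P - (1 - P))ᴴ * T * (ε • P - (1 - P)))).PosSemidef :=
      hT.posSemidef.conjTranspose_mul_mul_same _
    have h2 : ((1 - P)ᴴ * (b • 1 - T) * (1 - P)).PosSemidef :=
      (le_iff.1 hb).conjTranspose_mul_mul_same _
    have h3 := (h1.smul (inv_pos.2 hε).le).add (h2.smul (show 0 ≤ 1 + ε⁻¹ by positivity))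
    have hVX : V * ((1 + ε) • X) * Vᴴ = (1 + ε) • (P * T * P) := by
      simp only [hXdef, hP, Matrix.mul_assoc, Matrix.mul_smul, Matrix.smul_mul]
    have hST : S - T = ε⁻¹ • ((ε • P - (1 - P))ᴴ * T * (ε • P - (1 - P))) +
        (1 + ε⁻¹) • ((1 - P)ᴴ * (b • 1 - T) * (1 - P)) := by
      rw [hS, hVX]
      simp only [conjTranspose_sub, conjTranspose_smul, conjTranspose_one, hPh, star_trivial,
        Matrix.mul_sub, Matrix.sub_mul, Matrix.mul_smul, Matrix.smul_mul, Matrix.mul_one,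
        Matrix.one_mul, Matrix.mul_assoc, hPP, a]
      match_scalars <;> field_simp <;> ring
    rw [le_iff, hST]
    exact h3
  have hmono := hf.monotone.cfc_le_cfc hT hTS
  rw [hS, cfc_isometry hV (by simp [IsHermitian, hX.isHermitian.eq])] at hmono
  -- Compression by `V` kills the summand with `f a`, so the growth of `a` as `ε → 0` is harmless.
  have hcomp := (le_iff.1 hmono).conjTranspose_mul_mul_same V
  have hsc := le_iff.1 (hf.cfc_smul_le (show 1 ≤ 1 + ε by linarith) hX)
  have h := hcomp.add hsc
  rw [nonneg_iff_posSemidef]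
  convert h using 1
  have e1 : Vᴴ * (V * cfc f ((1 + ε) • X) * Vᴴ) * V = cfc f ((1 + ε) • X) := by
    simp only [← Matrix.mul_assoc, hV, Matrix.one_mul]
    rw [Matrix.mul_assoc, hV, Matrix.mul_one]
  have e2 : Vᴴ * (1 - V * Vᴴ) = 0 := by
    rw [Matrix.mul_sub, ← Matrix.mul_assoc, hV]; simp
  rw [Matrix.mul_sub, Matrix.sub_mul, Matrix.mul_add, Matrix.add_mul, e1, Matrix.mul_smul, e2,
    smul_zero, Matrix.zero_mul]
  module

end OperatorJensen

/-! ### Perspectives of commuting positive definite matrices. -/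

section OperatorPerspective

open Matrix
open scoped MatrixOrder

variable {n : Type*} [Fintype n] [DecidableEq n]

theorem Matrix.PosDef.cfc_sqrt_mul_self {R : Matrix n n ℂ} (hR : R.PosDef) :
    cfc Real.sqrt R * cfc Real.sqrt R = R := by
  rw [← cfc_mul Real.sqrt Real.sqrt R (R.continuousOn_spectrum _) (R.continuousOn_spectrum _)]
  conv_rhs => rw [← cfc_id ℝ R hR.isHermitian.isSelfAdjoint]
  exact cfc_congr fun x hx => Real.mul_self_sqrt (hR.pos_of_mem_spectrum hx).le

theorem Matrix.PosDef.posDef_cfc_sqrt {R : Matrix n n ℂ} (hR : R.PosDef) :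
    (cfc Real.sqrt R).PosDef :=
  hR.posDef_cfc fun _ => Real.sqrt_pos.2

/-- The perspective `f(L R⁻¹) R` of `f` at a pair of commuting matrices. -/
noncomputable def Matrix.perspective (f : ℝ → ℝ) (L R : Matrix n n ℂ) : Matrix n n ℂ :=
  cfc f (L * R⁻¹) * R

/-- With `S = √R`, the matrix `L R⁻¹` is `S⁻¹ L S⁻¹`. -/
theorem Matrix.mul_inv_eq_sqrt_conj {L R : Matrix n n ℂ} (hR : R.PosDef) (h : Commute L R) :
    L * R⁻¹ = (cfc Real.sqrt R)⁻¹ * L * (cfc Real.sqrt R)⁻¹ := by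
  have hS := hR.posDef_cfc_sqrt.isUnit
  have hc : Commute (cfc Real.sqrt R) L := h.symm.cfc_real Real.sqrt
  conv_lhs => rw [← hR.cfc_sqrt_mul_self, Matrix.mul_inv_rev, ← Matrix.mul_assoc]
  congr 1
  set S := cfc Real.sqrt R
  have h1 : S⁻¹ * S = 1 := nonsing_inv_mul S ((isUnit_iff_isUnit_det S).1 hS)
  have h2 : S * S⁻¹ = 1 := mul_nonsing_inv S ((isUnit_iff_isUnit_det S).1 hS)
  calc L * S⁻¹ = S⁻¹ * (S * L) * S⁻¹ := by
        rw [← Matrix.mul_assoc, h1, Matrix.one_mul]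
    _ = S⁻¹ * L := by rw [hc.eq, Matrix.mul_assoc, Matrix.mul_assoc, h2, Matrix.mul_one]

theorem Matrix.PosDef.mul_inv_of_commute {L R : Matrix n n ℂ} (hL : L.PosDef) (hR : R.PosDef)
    (h : Commute L R) : (L * R⁻¹).PosDef := by
  rw [mul_inv_eq_sqrt_conj hR h]
  have hS := hR.posDef_cfc_sqrt.inv
  have := (Matrix.IsUnit.posDef_star_left_conjugate_iff hS.isUnit).2 hL
  rwa [star_eq_conjTranspose, hS.isHermitian.eq] at this

theorem Matrix.perspective_eq_sqrt_conj (f : ℝ → ℝ) {L R : Matrix n n ℂ} (hR : R.PosDef)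
    (h : Commute L R) :
    perspective f L R = cfc Real.sqrt R * cfc f (L * R⁻¹) * cfc Real.sqrt R := by
  have hRR : Commute R⁻¹ R := by
    have hdet := (isUnit_iff_isUnit_det R).1 hR.isUnit
    rw [Commute, SemiconjBy, nonsing_inv_mul R hdet, mul_nonsing_inv R hdet]
  have hc : Commute (cfc f (L * R⁻¹)) (cfc Real.sqrt R) :=
    (((h.mul_left hRR).cfc_real f).symm.cfc_real Real.sqrt).symm
  rw [perspective, ← hc.eq, Matrix.mul_assoc, hR.cfc_sqrt_mul_self]

theorem Matrix.posDef_perspective {f : ℝ → ℝ} (hf : ∀ x, 0 < x → 0 < f x) {L R : Matrix n n ℂ}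
    (hL : L.PosDef) (hR : R.PosDef) (h : Commute L R) : (perspective f L R).PosDef := by
  rw [perspective_eq_sqrt_conj f hR h]
  have hS := hR.posDef_cfc_sqrt
  have := (Matrix.IsUnit.posDef_star_left_conjugate_iff hS.isUnit).2
    ((hL.mul_inv_of_commute hR h).posDef_cfc hf)
  rwa [star_eq_conjTranspose, hS.isHermitian.eq] at this

theorem Matrix.perspective_smul (f : ℝ → ℝ) {c : ℝ} (hc : c ≠ 0) (L : Matrix n n ℂ)
    {R : Matrix n n ℂ} (hR : R.PosDef) :
    perspective f (c • L) (c • R) = c • perspective f L R := by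
  have hinv : (c • R)⁻¹ = c⁻¹ • R⁻¹ := by
    refine inv_eq_left_inv ?_
    rw [smul_mul_smul_comm, inv_mul_cancel₀ hc,
      nonsing_inv_mul R ((isUnit_iff_isUnit_det R).1 hR.isUnit), one_smul]
  rw [perspective, perspective, hinv, smul_mul_smul_comm, mul_inv_cancel₀ hc, one_smul,
    Matrix.mul_smul]

/-- The perspective of a standard matrix monotone function is superadditive. -/
theorem IsStandardMatrixMonotone.perspective_add_le {f : ℝ → ℝ}
    (hf : IsStandardMatrixMonotone f) {L₁ R₁ L₂ R₂ : Matrix n n ℂ}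
    (hL₁ : L₁.PosDef) (hR₁ : R₁.PosDef) (h₁ : Commute L₁ R₁)
    (hL₂ : L₂.PosDef) (hR₂ : R₂.PosDef) (h₂ : Commute L₂ R₂)
    (h : Commute (L₁ + L₂) (R₁ + R₂)) :
    perspective f L₁ R₁ + perspective f L₂ R₂ ≤ perspective f (L₁ + L₂) (R₁ + R₂) := by
  have hR := hR₁.add hR₂
  have hT₁ := hL₁.mul_inv_of_commute hR₁ h₁
  have hT₂ := hL₂.mul_inv_of_commute hR₂ h₂
  rw [perspective_eq_sqrt_conj f hR₁ h₁, perspective_eq_sqrt_conj f hR₂ h₂,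
    perspective_eq_sqrt_conj f hR h, mul_inv_eq_sqrt_conj hR h]
  have hS₁S := hR₁.cfc_sqrt_mul_self
  have hS₂S := hR₂.cfc_sqrt_mul_self
  have hSS := hR.cfc_sqrt_mul_self
  have hS₁ := hR₁.posDef_cfc_sqrt
  have hS₂ := hR₂.posDef_cfc_sqrt
  have hS := hR.posDef_cfc_sqrt
  have conj_mul_inv : ∀ {L R : Matrix n n ℂ}, R.PosDef → Commute L R →
      cfc Real.sqrt R * (L * R⁻¹) * cfc Real.sqrt R = L := by
    intro L R hR h
    rw [mul_inv_eq_sqrt_conj hR h]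
    have hdet := (isUnit_iff_isUnit_det _).1 hR.posDef_cfc_sqrt.isUnit
    rw [Matrix.mul_assoc (_⁻¹), mul_nonsing_inv_cancel_left _ _ hdet, Matrix.mul_assoc,
      nonsing_inv_mul _ hdet, Matrix.mul_one]
  have hLT₁ := conj_mul_inv hR₁ h₁
  have hLT₂ := conj_mul_inv hR₂ h₂
  set T₁ := L₁ * R₁⁻¹
  set T₂ := L₂ * R₂⁻¹
  set S₁ := cfc Real.sqrt R₁
  set S₂ := cfc Real.sqrt R₂
  set S := cfc Real.sqrt (R₁ + R₂)
  have hdet := (isUnit_iff_isUnit_det S).1 hS.isUnit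
  have h1 : S⁻¹ * S = 1 := nonsing_inv_mul S hdet
  have h2 : S * S⁻¹ = 1 := mul_nonsing_inv S hdet
  -- The column of `S₁ S⁻¹` and `S₂ S⁻¹` is an isometry since `S₁² + S₂² = R₁ + R₂ = S²`; it
  -- compresses `T₁ ⊕ T₂` to `S⁻¹ (L₁ + L₂) S⁻¹`.
  have hVh : (fromRows (S₁ * S⁻¹) (S₂ * S⁻¹))ᴴ = fromCols (S⁻¹ * S₁) (S⁻¹ * S₂) := by
    rw [conjTranspose_fromRows_eq_fromCols_conjTranspose, conjTranspose_mul, conjTranspose_mul,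
      hS.inv.isHermitian.eq, hS₁.isHermitian.eq, hS₂.isHermitian.eq]
  have compress : ∀ A B : Matrix n n ℂ,
      (fromRows (S₁ * S⁻¹) (S₂ * S⁻¹))ᴴ * fromBlocks A 0 0 B * fromRows (S₁ * S⁻¹) (S₂ * S⁻¹) =
        S⁻¹ * (S₁ * A * S₁ + S₂ * B * S₂) * S⁻¹ := by
    intro A B
    rw [hVh, fromCols_mul_fromBlocks, fromCols_mul_fromRows]
    simp [Matrix.mul_add, Matrix.add_mul, Matrix.mul_assoc]
  have hV : (fromRows (S₁ * S⁻¹) (S₂ * S⁻¹))ᴴ * fromRows (S₁ * S⁻¹) (S₂ * S⁻¹) = 1 := by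
    have := compress 1 1
    rw [fromBlocks_one, Matrix.mul_one, Matrix.mul_one, Matrix.mul_one, hS₁S, hS₂S, ← hSS,
      ← Matrix.mul_assoc, h1, Matrix.one_mul, h2] at this
    exact this
  have hT : (fromBlocks T₁ 0 0 T₂).PosDef := by
    have hdet₁ := (isUnit_iff_isUnit_det T₁).1 hT₁.isUnit
    let _ : Invertible T₁ := T₁.invertibleOfIsUnitDet hdet₁
    refine PosSemidef.posDef_iff_isUnit ?_ |>.2 ?_
    · have := (PosDef.fromBlocks₁₁ (A := T₁) 0 T₂ hT₁).2
      simpa using this (by simpa using hT₂.posSemidef)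
    · rw [isUnit_iff_isUnit_det, det_fromBlocks_zero₂₁]
      exact hdet₁.mul ((isUnit_iff_isUnit_det T₂).1 hT₂.isUnit)
  have key := hf.jensen hV hT
  rw [cfc_fromBlocks hT₁.isHermitian hT₂.isHermitian, compress, compress, hLT₁, hLT₂] at key
  have hc := (le_iff.1 key).conjTranspose_mul_mul_same S
  rw [hS.isHermitian.eq, Matrix.mul_sub, Matrix.sub_mul] at hc
  have hcancel : ∀ X, S * (S⁻¹ * X * S⁻¹) * S = X := by
    intro X
    rw [Matrix.mul_assoc S⁻¹, mul_nonsing_inv_cancel_left _ _ hdet, Matrix.mul_assoc, h1,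
      Matrix.mul_one]
  rwa [hcancel] at hc

end OperatorPerspective

/-! ### The metric as a quadratic form, and its convexity. -/

section MonotoneMetric

open Matrix
open scoped MatrixOrder Kronecker

variable {n : Type*} [Fintype n] [DecidableEq n]

omit [DecidableEq n] in
theorem Matrix.re_star_dotProduct_comm (a b : n → ℂ) :
    (star a ⬝ᵥ b).re = (star b ⬝ᵥ a).re := by
  rw [star_dotProduct, Complex.star_def, Complex.conj_re]

/-- Expand `⟨c, M c⟩ ≥ 0` at `c = M⁻¹ a - b`; equality holds for `b = M⁻¹ a`. -/
theorem Matrix.PosDef.two_re_sub_le {M : Matrix n n ℂ} (hM : M.PosDef) (a b : n → ℂ) :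
    2 * (star a ⬝ᵥ b).re - (star b ⬝ᵥ M *ᵥ b).re ≤ (star a ⬝ᵥ M⁻¹ *ᵥ a).re := by
  have hdet := (isUnit_iff_isUnit_det M).1 hM.isUnit
  have h := (Complex.le_def.1 (hM.posSemidef.dotProduct_mulVec_nonneg (M⁻¹ *ᵥ a - b))).1
  have e1 : M *ᵥ (M⁻¹ *ᵥ a) = a := by rw [mulVec_mulVec, mul_nonsing_inv M hdet, one_mulVec]
  have e2 : ∀ c, star (M⁻¹ *ᵥ a) ⬝ᵥ c = star a ⬝ᵥ M⁻¹ *ᵥ c := by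
    intro c
    rw [star_mulVec, hM.inv.isHermitian.eq, dotProduct_mulVec]
  rw [mulVec_sub, e1, star_sub, sub_dotProduct, dotProduct_sub, dotProduct_sub, e2, e2,
    mulVec_mulVec, nonsing_inv_mul M hdet, one_mulVec] at h
  simp only [Complex.zero_re, Complex.sub_re, re_star_dotProduct_comm b a] at h
  linarith

theorem stdBasis_repr_apply {n : ℕ} (B : Matrix (Fin n) (Fin n) ℂ) (p : Fin n × Fin n) :
    (stdBasis ℂ (Fin n) (Fin n)).repr B p = B p.1 p.2 := by
  simp [stdBasis]

theorem toMatrix_mulLeft_stdBasis {n : ℕ} (D : Matrix (Fin n) (Fin n) ℂ) :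
    LinearMap.toMatrix (stdBasis ℂ (Fin n) (Fin n)) (stdBasis ℂ (Fin n) (Fin n))
      (LinearMap.mulLeft ℂ D) = D ⊗ₖ 1 := by
  ext ⟨i, j⟩ ⟨k, l⟩
  rw [LinearMap.toMatrix_apply, stdBasis_eq_single, stdBasis_repr_apply, LinearMap.mulLeft_apply]
  by_cases h : j = l
  · subst h; simp
  · simp [h]

/-- The transpose appears because the `(i, j)` entry of `E_kl D` is `δ_ik D_lj`. -/
theorem toMatrix_mulRight_stdBasis {n : ℕ} (D : Matrix (Fin n) (Fin n) ℂ) :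
    LinearMap.toMatrix (stdBasis ℂ (Fin n) (Fin n)) (stdBasis ℂ (Fin n) (Fin n))
      (LinearMap.mulRight ℂ D) = 1 ⊗ₖ Dᵀ := by
  ext ⟨i, j⟩ ⟨k, l⟩
  rw [LinearMap.toMatrix_apply, stdBasis_eq_single, stdBasis_repr_apply, LinearMap.mulRight_apply]
  by_cases h : i = k
  · subst h; simp
  · simp [h]

/-- The matrix of `J_D^f` in the basis of matrix units. -/
noncomputable def jMatrix {n : ℕ} (f : ℝ → ℝ) (D : Matrix (Fin n) (Fin n) ℂ) :
    Matrix (Fin n × Fin n) (Fin n × Fin n) ℂ :=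
  perspective f (D ⊗ₖ 1) (1 ⊗ₖ Dᵀ)

theorem jOp_eq_toLin {n : ℕ} (f : ℝ → ℝ) (D : Matrix (Fin n) (Fin n) ℂ) :
    jOp f D = toLin (stdBasis ℂ (Fin n) (Fin n)) (stdBasis ℂ (Fin n) (Fin n)) (jMatrix f D) := by
  have hR : (1 ⊗ₖ Dᵀ : Matrix (Fin n × Fin n) (Fin n × Fin n) ℂ)⁻¹ = 1 ⊗ₖ (D⁻¹)ᵀ := by
    rw [inv_kronecker, inv_one, transpose_nonsing_inv]
  rw [jOp, superCfc, modularOp, LinearMap.toMatrix_mul, toMatrix_mulLeft_stdBasis,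
    toMatrix_mulRight_stdBasis, jMatrix, perspective, hR,
    Matrix.toLin_mul _ (stdBasis ℂ (Fin n) (Fin n)),
    ← toMatrix_mulRight_stdBasis D, toLin_toMatrix]
  rfl

theorem commute_kronecker {n : ℕ} (C D : Matrix (Fin n) (Fin n) ℂ) :
    Commute (C ⊗ₖ (1 : Matrix (Fin n) (Fin n) ℂ)) (1 ⊗ₖ D) := by
  simp [Commute, SemiconjBy, ← mul_kronecker_mul]

theorem posDef_jMatrix {n : ℕ} {f : ℝ → ℝ} (hf : ∀ x, 0 < x → 0 < f x)
    {D : Matrix (Fin n) (Fin n) ℂ} (hD : D.PosDef) : (jMatrix f D).PosDef :=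
  posDef_perspective hf (hD.kronecker .one) (PosDef.one.kronecker hD.transpose)
    (commute_kronecker _ _)

theorem IsStandardMatrixMonotone.jMatrix_concave {n : ℕ} {f : ℝ → ℝ}
    (hf : IsStandardMatrixMonotone f) {D E : Matrix (Fin n) (Fin n) ℂ} (hD : D.PosDef)
    (hE : E.PosDef) {s t : ℝ} (hs : 0 < s) (ht : 0 < t) :
    s • jMatrix f D + t • jMatrix f E ≤ jMatrix f (s • D + t • E) := by
  have key : ∀ {D : Matrix (Fin n) (Fin n) ℂ} {s : ℝ}, D.PosDef → 0 < s →
      s • jMatrix f D = jMatrix f (s • D) := by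
    intro D s hD hs
    rw [jMatrix, jMatrix, ← perspective_smul f hs.ne' _ (PosDef.one.kronecker hD.transpose),
      transpose_smul, smul_kronecker, kronecker_smul]
  rw [key hD hs, key hE ht]
  have hD' := hD.smul hs
  have hE' := hE.smul ht
  simp only [jMatrix, add_kronecker, kronecker_add, transpose_add]
  refine hf.perspective_add_le (hD'.kronecker .one) (PosDef.one.kronecker hD'.transpose)
    (commute_kronecker _ _) (hE'.kronecker .one) (PosDef.one.kronecker hE'.transpose)
    (commute_kronecker _ _) ?_
  rw [← add_kronecker, ← kronecker_add]
  exact commute_kronecker _ _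

theorem isUnit_jOp {n : ℕ} {f : ℝ → ℝ} (hf : ∀ x, 0 < x → 0 < f x)
    {D : Matrix (Fin n) (Fin n) ℂ} (hD : D.PosDef) : IsUnit (jOp f D) := by
  rw [jOp_eq_toLin]
  exact (posDef_jMatrix hf hD).isUnit.map
    (Matrix.toLinAlgEquiv (stdBasis ℂ (Fin n) (Fin n)))

theorem monotoneMetric_eq {n : ℕ} {f : ℝ → ℝ} (hf : ∀ x, 0 < x → 0 < f x)
    {D A : Matrix (Fin n) (Fin n) ℂ} (hD : D.PosDef) (hA : A.IsHermitian) :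
    monotoneMetric f D A A =
      star (fun p : Fin n × Fin n => A p.1 p.2) ⬝ᵥ (jMatrix f D)⁻¹ *ᵥ fun p => A p.1 p.2 := by
  have hdet := (isUnit_iff_isUnit_det _).1 (posDef_jMatrix hf hD).isUnit
  have hinv : Ring.inverse (jOp f D) =
      toLin (stdBasis ℂ (Fin n) (Fin n)) (stdBasis ℂ (Fin n) (Fin n)) (jMatrix f D)⁻¹ := by
    have hmul : (toLin (stdBasis ℂ (Fin n) (Fin n)) (stdBasis ℂ (Fin n) (Fin n))
        (jMatrix f D)⁻¹) * jOp f D = 1 := by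
      rw [jOp_eq_toLin]
      refine (toLin_mul _ (stdBasis ℂ (Fin n) (Fin n)) _ _ _).symm.trans ?_
      rw [nonsing_inv_mul _ hdet, toLin_one]
      rfl
    have hu := isUnit_jOp hf hD
    calc Ring.inverse (jOp f D) = 1 * Ring.inverse (jOp f D) := (one_mul _).symm
      _ = _ := by rw [← hmul, mul_assoc, Ring.mul_inverse_cancel _ hu, mul_one]
  rw [monotoneMetric, hinv]
  set W := toLin (stdBasis ℂ (Fin n) (Fin n)) (stdBasis ℂ (Fin n) (Fin n)) (jMatrix f D)⁻¹ A
  have hW : (fun p : Fin n × Fin n => W p.1 p.2) =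
      (jMatrix f D)⁻¹ *ᵥ fun p => A p.1 p.2 := by
    have h := LinearMap.toMatrix_mulVec_repr (stdBasis ℂ (Fin n) (Fin n))
      (stdBasis ℂ (Fin n) (Fin n))
      (toLin (stdBasis ℂ (Fin n) (Fin n)) (stdBasis ℂ (Fin n) (Fin n)) (jMatrix f D)⁻¹) A
    rw [LinearMap.toMatrix_toLin] at h
    ext p
    have hp := congrFun h p
    rw [stdBasis_repr_apply] at hp
    refine hp.symm.trans ?_
    congr 2
  -- `A` being Hermitian, `Tr A W = Tr A* W`, the Hilbert–Schmidt product.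
  rw [← hW, trace, dotProduct, Fintype.sum_prod_type, Finset.sum_comm]
  refine Finset.sum_congr rfl fun i _ => ?_
  rw [diag_apply, mul_apply]
  refine Finset.sum_congr rfl fun j _ => ?_
  simp [hA.apply]

end MonotoneMetric

theorem mainTheorem5 (f : ℝ → ℝ) (hf : IsStandardMatrixMonotone f) (n : ℕ)
    (A : Matrix (Fin n) (Fin n) ℂ) (hA : A.IsHermitian) :
    (∀ D : Matrix (Fin n) (Fin n) ℂ, D.PosDef →
      IsUnit (jOp f D) ∧ (monotoneMetric f D A A).im = 0) ∧
    ConvexOn ℝ {D : Matrix (Fin n) (Fin n) ℂ | D.PosDef}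
      (fun D => (monotoneMetric f D A A).re) := by
  refine ⟨fun D hD => ⟨isUnit_jOp hf.pos hD, ?_⟩, ?_⟩
  · rw [monotoneMetric_eq hf.pos hD hA]
    exact (Complex.le_def.1
      ((posDef_jMatrix hf.pos hD).inv.posSemidef.dotProduct_mulVec_nonneg _)).2.symm
  · refine convexOn_iff_forall_pos.2 ⟨?_, ?_⟩
    · refine convex_iff_forall_pos.2 fun D hD E hE s t hs ht _ => ?_
      exact (Matrix.PosDef.smul hD hs).add (Matrix.PosDef.smul hE ht)
    · intro D hD E hE s t hs ht hst
      have hF : (s • D + t • E).PosDef :=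
        (Matrix.PosDef.smul hD hs).add (Matrix.PosDef.smul hE ht)
      simp only [monotoneMetric_eq hf.pos hD hA, monotoneMetric_eq hf.pos hE hA,
        monotoneMetric_eq hf.pos hF hA, smul_eq_mul]
      set a : Fin n × Fin n → ℂ := fun p => A p.1 p.2
      have hJ := posDef_jMatrix hf.pos hF
      -- The maximiser at `s D + t E`, used as a trial vector at both `D` and `E`.
      set b := Matrix.mulVec (jMatrix f (s • D + t • E))⁻¹ a with hb
      have h1 := (posDef_jMatrix hf.pos hD).two_re_sub_le a b
      have h2 := (posDef_jMatrix hf.pos hE).two_re_sub_le a b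
      have h3 := (Complex.le_def.1
        (Matrix.PosSemidef.dotProduct_mulVec_nonneg (hf.jMatrix_concave hD hE hs ht) b)).1
      have hMb : Matrix.mulVec (jMatrix f (s • D + t • E)) b = a := by
        rw [hb, Matrix.mulVec_mulVec, Matrix.mul_nonsing_inv _
          ((Matrix.isUnit_iff_isUnit_det _).1 hJ.isUnit), Matrix.one_mulVec]
      have h4 := Matrix.re_star_dotProduct_comm b a
      simp only [Matrix.sub_mulVec, Matrix.add_mulVec, Matrix.smul_mulVec, hMb, dotProduct_sub,
        dotProduct_add, dotProduct_smul, Complex.sub_re, Complex.add_re, Complex.zero_re,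
        Complex.smul_re, smul_eq_mul, h4] at h3
      have h5 := mul_le_mul_of_nonneg_left h1 hs.le
      have h6 := mul_le_mul_of_nonneg_left h2 ht.le
      have h7 : (star a ⬝ᵥ b).re = s * (star a ⬝ᵥ b).re + t * (star a ⬝ᵥ b).re := by
        rw [← add_mul, hst, one_mul]
      linarith
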